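/- Let $\text{SmallGroup}(55,1)=\mathbb Z_{11}\rtimes\mathbb Z_5=\langle X,Y : X^{11}=Y^5=1,\ YX=X^4Y\rangle$ be the nonabelian group of order $55$. For a finite group $G$, the integer group determinants of $G$ are the integers $\det\left(a_{gh^{-1}}\right)_{g,h\in G}$, where $\sum_{g\in G} a_g\, g$ runs through all elements of the group ring $\mathbb Z[G]$. Theorem. The integer group determinants for $\mathbb Z_{11}\rtimes\mathbb Z_5$ are exactly the integers of the form $$ m\, N\left(m+11\alpha+\tfrac12\left(11+i\sqrt{11}\right)\beta\right)^5, \qquad m,\alpha,\beta\in\mathbb Z,\quad 5\nmid m \ \text{ or }\ 25\mid m, $$ where $N$ denotes the norm from $\mathbb Q(i\sqrt{11})$ to $\mathbb Q$. -/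

import Mathlib

/-- The group determinant of an element `F = ∑ a_g g` of the integral group ring: the determinant
of the matrix `(a_{g h⁻¹})`, with rows indexed by `g` and columns by `h`. -/
def groupDet {G : Type*} [Group G] [Fintype G] [DecidableEq G] (F : MonoidAlgebra ℤ G) : ℤ :=
  Matrix.det (Matrix.of fun g h : G => F.coeff (g * h⁻¹))

/-- The set of values taken by the group determinant of `G` on `ℤ[G]`. -/
def integerGroupDets (G : Type*) [Group G] [Fintype G] [DecidableEq G] : Set ℤ :=
  Set.range fun F : MonoidAlgebra ℤ G => groupDet F

/-- The relators of `⟨X, Y : X¹¹ = Y⁵ = 1, Y X = X⁴ Y⟩`, with `X`, `Y` the free generators with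
index `0`, `1`. -/
def smallGroup55Rels : Set (FreeGroup (Fin 2)) :=
  let X := FreeGroup.of (0 : Fin 2)
  let Y := FreeGroup.of (1 : Fin 2)
  {X ^ 11, Y ^ 5, Y * X * (X ^ 4 * Y)⁻¹}

/-- `SmallGroup(55,1)`, the nonabelian group `ℤ₁₁ ⋊ ℤ₅` of order `55`, by its presentation
`⟨X, Y : X¹¹ = Y⁵ = 1, Y X = X⁴ Y⟩`. -/
abbrev SmallGroup55 : Type := PresentedGroup smallGroup55Rels

namespace SmallGroup55

/-- The generator `X`. -/
def X : SmallGroup55 := PresentedGroup.of 0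

/-- The generator `Y`. -/
def Y : SmallGroup55 := PresentedGroup.of 1

theorem X_pow : X ^ 11 = 1 :=
  PresentedGroup.one_of_mem (rels := smallGroup55Rels) (x := FreeGroup.of 0 ^ 11)
    (by simp [smallGroup55Rels])

theorem Y_pow : Y ^ 5 = 1 :=
  PresentedGroup.one_of_mem (rels := smallGroup55Rels) (x := FreeGroup.of 1 ^ 5)
    (by simp [smallGroup55Rels])

theorem Y_mul_X : Y * X = X ^ 4 * Y :=
  PresentedGroup.mk_eq_mk_of_mul_inv_mem (rels := smallGroup55Rels)
    (x := FreeGroup.of 1 * FreeGroup.of 0) (y := FreeGroup.of 0 ^ 4 * FreeGroup.of 1)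
    (by simp [smallGroup55Rels])

theorem Y_mul_X_pow (i : ℕ) : Y * X ^ i = X ^ (4 * i) * Y := by
  induction i with
  | zero => simp
  | succ k ih =>
    rw [pow_succ, ← mul_assoc, ih, mul_assoc, Y_mul_X, ← mul_assoc, ← pow_add, mul_add_one]

/-- Every element has the form `Xⁱ Yʲ`. -/
theorem exists_normal_form (g : SmallGroup55) :
    ∃ i : Fin 11, ∃ j : Fin 5, X ^ (i : ℕ) * Y ^ (j : ℕ) = g := by
  suffices h : ∃ i j : ℕ, X ^ i * Y ^ j = g by
    obtain ⟨i, j, rfl⟩ := h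
    refine ⟨⟨i % 11, Nat.mod_lt _ (by norm_num)⟩, ⟨j % 5, Nat.mod_lt _ (by norm_num)⟩, ?_⟩
    simp only
    rw [← pow_eq_pow_mod i X_pow, ← pow_eq_pow_mod j Y_pow]
  have hX : ∀ g : SmallGroup55, (∃ i j : ℕ, X ^ i * Y ^ j = g) →
      ∃ i j : ℕ, X ^ i * Y ^ j = X * g := by
    rintro _ ⟨i, j, rfl⟩
    exact ⟨i + 1, j, by rw [pow_succ', mul_assoc]⟩
  have hY : ∀ g : SmallGroup55, (∃ i j : ℕ, X ^ i * Y ^ j = g) →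
      ∃ i j : ℕ, X ^ i * Y ^ j = Y * g := by
    rintro _ ⟨i, j, rfl⟩
    exact ⟨4 * i, j + 1, by rw [← mul_assoc, Y_mul_X_pow, mul_assoc, pow_succ']⟩
  have hXn : ∀ (n : ℕ) (g : SmallGroup55), (∃ i j : ℕ, X ^ i * Y ^ j = g) →
      ∃ i j : ℕ, X ^ i * Y ^ j = X ^ n * g := by
    intro n
    induction n with
    | zero => intro g h; simpa using h
    | succ k ih => intro g h; rw [pow_succ', mul_assoc]; exact hX _ (ih g h)
  have hYn : ∀ (n : ℕ) (g : SmallGroup55), (∃ i j : ℕ, X ^ i * Y ^ j = g) →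
      ∃ i j : ℕ, X ^ i * Y ^ j = Y ^ n * g := by
    intro n
    induction n with
    | zero => intro g h; simpa using h
    | succ k ih => intro g h; rw [pow_succ', mul_assoc]; exact hY _ (ih g h)
  have hXinv : X⁻¹ = X ^ 10 := inv_eq_of_mul_eq_one_right (by rw [← pow_succ', X_pow])
  have hYinv : Y⁻¹ = Y ^ 4 := inv_eq_of_mul_eq_one_right (by rw [← pow_succ', Y_pow])
  have hg : g ∈ Subgroup.closure (Set.range (PresentedGroup.of (rels := smallGroup55Rels))) := by
    rw [PresentedGroup.closure_range_of]; trivial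
  induction hg using Subgroup.closure_induction_left with
  | one => exact ⟨0, 0, by simp⟩
  | mul_left x hx y _ ih =>
    obtain ⟨k, rfl⟩ := hx
    fin_cases k
    · exact hX y ih
    · exact hY y ih
  | inv_mul_cancel x hx y _ ih =>
    obtain ⟨k, rfl⟩ := hx
    fin_cases k
    · exact (congrArg (fun z => ∃ i j : ℕ, X ^ i * Y ^ j = z * y) hXinv).mpr (hXn 10 y ih)
    · exact (congrArg (fun z => ∃ i j : ℕ, X ^ i * Y ^ j = z * y) hYinv).mpr (hYn 4 y ih)

/-- The group is finite, so that its group determinant makes sense. -/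
instance instFinite : Finite SmallGroup55 :=
  Finite.of_surjective (fun p : Fin 11 × Fin 5 => X ^ (p.1 : ℕ) * Y ^ (p.2 : ℕ)) fun g => by
    obtain ⟨i, j, h⟩ := exists_normal_form g
    exact ⟨(i, j), h⟩

noncomputable instance instFintype : Fintype SmallGroup55 := Fintype.ofFinite _

noncomputable instance instDecidableEq : DecidableEq SmallGroup55 := Classical.decEq _

end SmallGroup55

open IntermediateField in
/-- The imaginary quadratic field `ℚ(i√11)`, as a subfield of `ℂ`. -/
noncomputable abbrev QuadField11 : IntermediateField ℚ ℂ := ℚ⟮Complex.I * (√11 : ℝ)⟯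

/-- The element `i√11` of `ℚ(i√11)`. -/
noncomputable def iSqrt11 : QuadField11 :=
  IntermediateField.AdjoinSimple.gen ℚ (Complex.I * (√11 : ℝ))

namespace SmallGroup55

/-! ### Uniqueness of the normal form -/

/-- The action of `SmallGroup55` on `ℤ/11` with `X : t ↦ t + 1` and `Y : t ↦ 4 t`. -/
noncomputable def affineAction : SmallGroup55 →* Equiv.Perm (ZMod 11) :=
  PresentedGroup.toGroup (rels := smallGroup55Rels)
    (f := ![Equiv.addRight 1, ⟨fun t => 4 * t, fun t => 3 * t, by decide, by decide⟩]) (by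
      intro r hr
      simp only [smallGroup55Rels, Set.mem_insert_iff, Set.mem_singleton_iff] at hr
      rcases hr with rfl | rfl | rfl
      · simp only [map_pow, FreeGroup.lift_apply_of]
        decide
      · simp only [map_pow, FreeGroup.lift_apply_of]
        decide
      · rw [map_mul, map_inv, mul_inv_eq_one]
        simp only [map_pow, map_mul, FreeGroup.lift_apply_of]
        decide)

theorem affineAction_X (t : ZMod 11) : affineAction X t = t + 1 := by
  simp [affineAction, X]

theorem affineAction_Y (t : ZMod 11) : affineAction Y t = 4 * t := by
  simp [affineAction, Y]

theorem affineAction_X_pow (n : ℕ) (t : ZMod 11) : affineAction (X ^ n) t = t + n := by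
  induction n with
  | zero => simp
  | succ k ih =>
    rw [pow_succ', map_mul, Equiv.Perm.mul_apply, ih, affineAction_X]
    push_cast
    ring

theorem affineAction_Y_pow (n : ℕ) (t : ZMod 11) : affineAction (Y ^ n) t = 4 ^ n * t := by
  induction n with
  | zero => simp
  | succ k ih =>
    rw [pow_succ', map_mul, Equiv.Perm.mul_apply, ih, affineAction_Y]
    ring

/-- The power of `X` with exponent in `ℤ/11`. -/
noncomputable def xPow (d : ZMod 11) : SmallGroup55 := X ^ d.val

/-- The power of `Y` with exponent in `ℤ/5`. -/
noncomputable def yPow (k : ZMod 5) : SmallGroup55 := Y ^ k.val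

theorem xPow_add (d e : ZMod 11) : xPow (d + e) = xPow d * xPow e := by
  rw [xPow, xPow, xPow, ZMod.val_add, ← pow_add, ← pow_eq_pow_mod _ X_pow]

theorem yPow_add (d e : ZMod 5) : yPow (d + e) = yPow d * yPow e := by
  rw [yPow, yPow, yPow, ZMod.val_add, ← pow_add, ← pow_eq_pow_mod _ Y_pow]

theorem xPow_zero : xPow 0 = 1 := by simp [xPow]

theorem yPow_zero : yPow 0 = 1 := by simp [yPow]

theorem xPow_neg (d : ZMod 11) : xPow (-d) = (xPow d)⁻¹ := by
  rw [eq_inv_iff_mul_eq_one, ← xPow_add, neg_add_cancel, xPow_zero]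

theorem yPow_neg (d : ZMod 5) : yPow (-d) = (yPow d)⁻¹ := by
  rw [eq_inv_iff_mul_eq_one, ← yPow_add, neg_add_cancel, yPow_zero]

theorem xPow_natCast (n : ℕ) : xPow n = X ^ n := by
  rw [xPow, ZMod.val_natCast, ← pow_eq_pow_mod _ X_pow]

theorem Y_mul_xPow (d : ZMod 11) : Y * xPow d = xPow (4 * d) * Y := by
  have h : (4 * d : ZMod 11) = ((4 * d.val : ℕ) : ZMod 11) := by simp
  rw [h, xPow_natCast, xPow, Y_mul_X_pow]

theorem yPow_mul_xPow (k : ZMod 5) (d : ZMod 11) :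
    yPow k * xPow d = xPow (4 ^ k.val * d) * yPow k := by
  unfold yPow
  induction k.val with
  | zero => simp
  | succ n ih =>
    rw [pow_succ', mul_assoc, ih, ← mul_assoc, Y_mul_xPow, mul_assoc]
    ring_nf

theorem affineAction_xPow_mul_yPow (d : ZMod 11) (k : ZMod 5) (t : ZMod 11) :
    affineAction (xPow d * yPow k) t = 4 ^ k.val * t + d := by
  rw [map_mul, Equiv.Perm.mul_apply, xPow, yPow, affineAction_Y_pow, affineAction_X_pow,
    ZMod.natCast_zmod_val]

/-- The normal form `Xᵈ Yᵏ` as a bijection. -/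
noncomputable def normalFormEquiv : ZMod 11 × ZMod 5 ≃ SmallGroup55 :=
  Equiv.ofBijective (fun p => xPow p.1 * yPow p.2) <| by
    constructor
    · rintro ⟨d, k⟩ ⟨d', k'⟩ h
      have key : ∀ t : ZMod 11, 4 ^ k.val * t + d = 4 ^ k'.val * t + d' := by
        intro t
        rw [← affineAction_xPow_mul_yPow, ← affineAction_xPow_mul_yPow]
        exact congrArg (fun g => affineAction g t) h
      have hd : d = d' := by simpa using key 0
      have hk : (4 : ZMod 11) ^ k.val = 4 ^ k'.val := by simpa [hd] using key 1
      have inj : ∀ a b : ZMod 5, (4 : ZMod 11) ^ a.val = 4 ^ b.val → a = b := by decide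
      rw [hd, inj _ _ hk]
    · intro g
      obtain ⟨i, j, h⟩ := exists_normal_form g
      refine ⟨((i : ℕ), (j : ℕ)), ?_⟩
      simp only [xPow_natCast, yPow, ZMod.val_natCast]
      rw [← pow_eq_pow_mod _ Y_pow, h]

theorem normalFormEquiv_apply (p : ZMod 11 × ZMod 5) :
    normalFormEquiv p = xPow p.1 * yPow p.2 := rfl

/-- The opposite normal form `Yᵏ Xᵈ` as a bijection. -/
noncomputable def oppNormalFormEquiv : ZMod 11 × ZMod 5 ≃ SmallGroup55 :=
  (Equiv.neg _).trans (normalFormEquiv.trans (Equiv.inv _))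

theorem oppNormalFormEquiv_apply (p : ZMod 11 × ZMod 5) :
    oppNormalFormEquiv p = yPow p.2 * xPow p.1 := by
  simp [oppNormalFormEquiv, normalFormEquiv_apply, xPow_neg, yPow_neg]

theorem oppNormalFormEquiv_mul_inv (p q : ZMod 11 × ZMod 5) :
    oppNormalFormEquiv p * (oppNormalFormEquiv q)⁻¹ =
      normalFormEquiv (4 ^ p.2.val * (p.1 - q.1), p.2 - q.2) := by
  rw [oppNormalFormEquiv_apply, oppNormalFormEquiv_apply, normalFormEquiv_apply, mul_inv_rev,
    ← xPow_neg, ← yPow_neg, sub_eq_add_neg p.2, yPow_add, ← mul_assoc _ (yPow p.2),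
    ← yPow_mul_xPow, sub_eq_add_neg, xPow_add]
  simp only [mul_assoc]

end SmallGroup55

/-- The group ring `ℤ[ℤ/11]`. -/
abbrev CyclicRing11 : Type := AddMonoidAlgebra ℤ (ZMod 11)

open SmallGroup55

/-- The matrix of left multiplication by `∑ f_k(X) Yᵏ` on `ℤ[SmallGroup55]`. -/
def leftMulMatrix55 (f : ZMod 5 → CyclicRing11) :
    Matrix (ZMod 11 × ZMod 5) (ZMod 11 × ZMod 5) ℤ :=
  Matrix.of fun p q => (f (p.2 - q.2)).coeff (4 ^ p.2.val * (p.1 - q.1))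

theorem groupDet_eq_det_leftMulMatrix55 (F : MonoidAlgebra ℤ SmallGroup55)
    (f : ZMod 5 → CyclicRing11)
    (h : ∀ d k, F.coeff (normalFormEquiv (d, k)) = (f k).coeff d) :
    groupDet F = (leftMulMatrix55 f).det := by
  rw [groupDet, ← Matrix.det_submatrix_equiv_self oppNormalFormEquiv]
  refine congrArg Matrix.det ?_
  ext p q
  rw [Matrix.submatrix_apply, Matrix.of_apply, oppNormalFormEquiv_mul_inv, h]
  rfl

theorem integerGroupDets_smallGroup55_eq_range :
    integerGroupDets SmallGroup55 = Set.range fun f => (leftMulMatrix55 f).det := by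
  ext z
  constructor
  · rintro ⟨F, rfl⟩
    refine ⟨fun k => .ofCoeff (Finsupp.equivFunOnFinite.symm
      fun d => F.coeff (normalFormEquiv (d, k))), ?_⟩
    refine (groupDet_eq_det_leftMulMatrix55 F _ fun d k => ?_).symm
    simp
  · rintro ⟨f, rfl⟩
    refine ⟨.ofCoeff (Finsupp.equivFunOnFinite.symm
      fun g => (f (normalFormEquiv.symm g).2).coeff (normalFormEquiv.symm g).1), ?_⟩
    refine groupDet_eq_det_leftMulMatrix55 _ f fun d k => ?_
    simp
/-! ### The norm of `ℚ(i√11)` -/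

section

open IntermediateField

theorem I_mul_sqrt_eleven_sq : (Complex.I * (√11 : ℝ)) ^ 2 = -11 := by
  rw [mul_pow, Complex.I_sq, ← Complex.ofReal_pow, Real.sq_sqrt (by norm_num)]
  norm_num

theorem iSqrt11_mul_self : iSqrt11 * iSqrt11 = -11 := by
  apply Subtype.ext
  have h := I_mul_sqrt_eleven_sq
  rw [sq] at h
  change (Complex.I * (√11 : ℝ)) * (Complex.I * (√11 : ℝ)) = ((-11 : QuadField11) : ℂ)
  rw [h]
  push_cast
  rfl

theorem aeval_X_sq_add_eleven :
    Polynomial.aeval (Complex.I * (√11 : ℝ))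
      (Polynomial.X ^ 2 + Polynomial.C 11 : Polynomial ℚ) = 0 := by
  simp [I_mul_sqrt_eleven_sq]

theorem minpoly_I_mul_sqrt_eleven :
    minpoly ℚ (Complex.I * (√11 : ℝ)) = Polynomial.X ^ 2 + Polynomial.C 11 := by
  refine (minpoly.eq_of_irreducible_of_monic ?_ aeval_X_sq_add_eleven
    (Polynomial.monic_X_pow_add_C _ two_ne_zero)).symm
  have hdeg : (Polynomial.X ^ 2 + Polynomial.C 11 : Polynomial ℚ).natDegree = 2 :=
    Polynomial.natDegree_X_pow_add_C
  rw [Polynomial.irreducible_iff_roots_eq_zero_of_degree_le_three (by omega) (by omega),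
    Multiset.eq_zero_iff_forall_notMem]
  intro r hr
  have h := (Polynomial.mem_roots'.1 hr).2
  simp only [Polynomial.IsRoot.def, Polynomial.eval_add, Polynomial.eval_pow, Polynomial.eval_X,
    Polynomial.eval_C] at h
  nlinarith [sq_nonneg r]

theorem norm_add_mul_iSqrt11 (a b : ℚ) :
    Algebra.norm ℚ ((a : QuadField11) + (b : QuadField11) * iSqrt11) = a ^ 2 + 11 * b ^ 2 := by
  have hint : IsIntegral ℚ (Complex.I * (√11 : ℝ)) :=
    ⟨_, Polynomial.monic_X_pow_add_C _ two_ne_zero, aeval_X_sq_add_eleven⟩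
  have hdim : (adjoin.powerBasis hint).dim = 2 := by
    rw [adjoin.powerBasis_dim, minpoly_I_mul_sqrt_eleven, Polynomial.natDegree_X_pow_add_C]
  let B : Module.Basis (Fin 2) ℚ QuadField11 :=
    (adjoin.powerBasis hint).basis.reindex (finCongr hdim)
  have h0 : B 0 = 1 := by simp [B]
  have h1 : B 1 = iSqrt11 := by simp [B, iSqrt11]
  have e0 : ((a : QuadField11) + (b : QuadField11) * iSqrt11) * B 0 = a • B 0 + b • B 1 := by
    rw [h0, h1, Algebra.smul_def, Algebra.smul_def]
    simp
  have e1 : ((a : QuadField11) + (b : QuadField11) * iSqrt11) * B 1 =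
      (-11 * b) • B 0 + a • B 1 := by
    rw [h0, h1, Algebra.smul_def, Algebra.smul_def]
    simp only [map_mul, map_neg, eq_ratCast, map_ofNat]
    linear_combination (b : QuadField11) * iSqrt11_mul_self
  rw [Algebra.norm_eq_matrix_det B, Matrix.det_fin_two]
  simp only [Algebra.leftMulMatrix_eq_repr_mul, e0, e1]
  simp
  ring

theorem norm_quadField11_integer (m α β : ℤ) :
    Algebra.norm ℚ ((m : QuadField11) + 11 * (α : QuadField11)
      + (1 / 2) * (11 + iSqrt11) * (β : QuadField11)) =
      (((m + 11 * α) ^ 2 + 11 * (m + 11 * α) * β + 33 * β ^ 2 : ℤ) : ℚ) := by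
  have h : (m : QuadField11) + 11 * (α : QuadField11)
      + (1 / 2) * (11 + iSqrt11) * (β : QuadField11) =
      ((m + 11 * α + 11 / 2 * β : ℚ) : QuadField11) + ((β / 2 : ℚ) : QuadField11) * iSqrt11 := by
    push_cast
    ring
  rw [h, norm_add_mul_iSqrt11]
  push_cast
  ring

end

@[to_additive]
theorem ZMod.prod_univ_eleven {M : Type*} [CommMonoid M] (g : ZMod 11 → M) :
    ∏ d, g d = g 0 * g 1 * g 2 * g 3 * g 4 * g 5 * g 6 * g 7 * g 8 * g 9 * g 10 := by
  have h : ∀ g : Fin 11 → M,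
      ∏ d, g d = g 0 * g 1 * g 2 * g 3 * g 4 * g 5 * g 6 * g 7 * g 8 * g 9 * g 10 := by
    intro g
    rw [Fin.prod_univ_castSucc, Fin.prod_univ_castSucc, Fin.prod_univ_castSucc,
      Fin.prod_univ_eight]
    rfl
  exact h g

/-! ### The determinant as a product over the characters of `ℤ/11` -/

namespace CyclicRing11

/-- The ring endomorphism `x ↦ xᶜ` of `ℤ[ℤ/11]`. -/
noncomputable def powMap (c : ZMod 11) : CyclicRing11 →+* CyclicRing11 :=
  AddMonoidAlgebra.mapDomainRingHom ℤ (AddMonoidHom.mulLeft c)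

theorem powMap_single (c d : ZMod 11) (a : ℤ) :
    powMap c (.single d a) = .single (c * d) a := by
  simp [powMap]

theorem coeff_powMap (c c' : ZMod 11) (h : c' * c = 1) (r : CyclicRing11) (d : ZMod 11) :
    (powMap c r).coeff d = r.coeff (c' * d) := by
  have hd : d = AddMonoidHom.mulLeft c (c' * d) := by
    simp [← mul_assoc, mul_comm c c', h]
  have hinj : Function.Injective (AddMonoidHom.mulLeft c) := by
    intro a b hab
    have h2 : c * a = c * b := hab
    calc a = c' * c * a := by rw [h, one_mul]
      _ = c' * c * b := by rw [mul_assoc, h2, mul_assoc]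
      _ = b := by rw [h, one_mul]
  conv_lhs => rw [hd]
  exact Finsupp.mapDomain_apply hinj _ _

theorem powMap_powMap (c c' : ZMod 11) (r : CyclicRing11) :
    powMap c (powMap c' r) = powMap (c * c') r := by
  have h : (powMap c).comp (powMap c') = powMap (c * c') := by
    apply AddMonoidAlgebra.ringHom_ext
    · intro a
      simp [powMap_single]
    · intro d
      simp [powMap_single, mul_assoc]
  exact congrArg (fun g => g r) h

/-- The extension of a character of `ℤ/11` to the group ring. -/
noncomputable def evalChar {A : Type*} [CommRing A] (ψ : AddChar (ZMod 11) A) :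
    CyclicRing11 →+* A :=
  (AddMonoidAlgebra.lift ℤ A (ZMod 11) ψ.toMonoidHom).toRingHom

theorem evalChar_single {A : Type*} [CommRing A] (ψ : AddChar (ZMod 11) A) (d : ZMod 11) (a : ℤ) :
    evalChar ψ (.single d a) = a * ψ d := by
  simp [evalChar]

theorem evalChar_eq_sum {A : Type*} [CommRing A] (ψ : AddChar (ZMod 11) A) (r : CyclicRing11) :
    evalChar ψ r = ∑ d, (r.coeff d : A) * ψ d := by
  have h : r = ∑ d, .single d (r.coeff d) := by
    ext d
    simp [AddMonoidAlgebra.coeff_sum]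
  conv_lhs => rw [h]
  simp [evalChar_single]

end CyclicRing11

open CyclicRing11

/-- The matrix of left multiplication by `∑ f_k(X) Yᵏ` on `ℤ[SmallGroup55]` over `ℤ[⟨X⟩]`. -/
noncomputable def twistedCirculant (f : ZMod 5 → CyclicRing11) :
    Matrix (ZMod 5) (ZMod 5) CyclicRing11 :=
  Matrix.of fun i j => powMap (3 ^ i.val) (f (i - j))

theorem four_pow_mul_three_pow (j : ZMod 5) : (4 : ZMod 11) ^ j.val * 3 ^ j.val = 1 := by
  rw [← mul_pow, show (4 * 3 : ZMod 11) = 1 by decide, one_pow]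

theorem det_fourier_ne_zero {ψ : AddChar (ZMod 11) ℂ} (hψ : ψ.IsPrimitive) :
    (Matrix.of fun i k : ZMod 11 => ψ (-(k * i))).det ≠ 0 := by
  have h : (Matrix.of fun i k : ZMod 11 => ψ (k * i)) * (Matrix.of fun i k => ψ (-(k * i))) =
      (11 : ℂ) • (1 : Matrix (ZMod 11) (ZMod 11) ℂ) := by
    ext i k
    rw [Matrix.mul_apply]
    have h2 : ∀ j : ZMod 11, (Matrix.of fun i k : ZMod 11 => ψ (k * i)) i j *
        (Matrix.of fun i k : ZMod 11 => ψ (-(k * i))) j k = ψ (j * (i - k)) := by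
      intro j
      rw [Matrix.of_apply, Matrix.of_apply, ← AddChar.map_add_eq_mul]
      ring_nf
    simp only [h2, AddChar.sum_mulShift _ hψ, Matrix.smul_apply, Matrix.one_apply, sub_eq_zero]
    simp
  intro h0
  have h3 := congrArg Matrix.det h
  rw [Matrix.det_mul, h0, mul_zero, Matrix.det_smul, Matrix.det_one] at h3
  norm_num at h3

theorem evalChar_twistedCirculant (ψ : AddChar (ZMod 11) ℂ) (f : ZMod 5 → CyclicRing11)
    (i j : ZMod 5) :
    evalChar ψ (twistedCirculant f i j) =
      ∑ d, ((f (i - j)).coeff (4 ^ i.val * d) : ℂ) * ψ d := by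
  rw [evalChar_eq_sum]
  simp only [twistedCirculant, Matrix.of_apply,
    coeff_powMap _ _ (four_pow_mul_three_pow i)]

theorem leftMulMatrix55_mul_fourier (ψ : AddChar (ZMod 11) ℂ) (f : ZMod 5 → CyclicRing11) :
    (leftMulMatrix55 f).map (Int.castRingHom ℂ) *
      Matrix.kroneckerMap (· * ·) (Matrix.of fun i k : ZMod 11 => ψ (-(k * i))) (1 : Matrix (ZMod 5) _ ℂ) =
    Matrix.kroneckerMap (· * ·) (Matrix.of fun i k : ZMod 11 => ψ (-(k * i))) (1 : Matrix (ZMod 5) _ ℂ) *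
      (Matrix.blockDiagonal fun k =>
        (twistedCirculant f).map (evalChar (ψ.mulShift k))).submatrix Prod.swap Prod.swap := by
  ext ⟨i, j⟩ ⟨k, j'⟩
  rw [Matrix.mul_apply, Matrix.mul_apply, Fintype.sum_prod_type, Fintype.sum_prod_type]
  simp only [Matrix.kroneckerMap_apply, Matrix.map_apply, leftMulMatrix55, Matrix.of_apply,
    Matrix.one_apply, Matrix.submatrix_apply, Prod.swap_prod_mk, Matrix.blockDiagonal_apply,
    mul_ite, mul_one, mul_zero, ite_mul, zero_mul]
  conv_rhs => rw [Finset.sum_comm]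
  simp only [Finset.sum_ite_eq, Finset.sum_ite_eq', Finset.mem_univ, if_true,
    evalChar_twistedCirculant]
  rw [Finset.mul_sum, ← Equiv.sum_comp (Equiv.subLeft i)]
  refine Finset.sum_congr rfl fun d _ => ?_
  simp only [Equiv.subLeft_apply, sub_sub_cancel, AddChar.mulShift_apply, eq_intCast]
  rw [mul_left_comm, ← AddChar.map_add_eq_mul]
  ring_nf

theorem det_leftMulMatrix55 {ψ : AddChar (ZMod 11) ℂ} (hψ : ψ.IsPrimitive)
    (f : ZMod 5 → CyclicRing11) :
    ((leftMulMatrix55 f).det : ℂ) = ∏ k, evalChar (ψ.mulShift k) (twistedCirculant f).det := by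
  have h := congrArg Matrix.det (leftMulMatrix55_mul_fourier ψ f)
  have hsub : ((Matrix.blockDiagonal fun k =>
      (twistedCirculant f).map (evalChar (ψ.mulShift k))).submatrix Prod.swap Prod.swap).det =
      (Matrix.blockDiagonal fun k => (twistedCirculant f).map (evalChar (ψ.mulShift k))).det :=
    Matrix.det_submatrix_equiv_self (Equiv.prodComm _ _) _
  rw [Matrix.det_mul, Matrix.det_mul, mul_comm, hsub, Matrix.det_blockDiagonal] at h
  have hne : (Matrix.kroneckerMap (· * ·) (Matrix.of fun i k : ZMod 11 => ψ (-(k * i)))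
      (1 : Matrix (ZMod 5) (ZMod 5) ℂ)).det ≠ 0 := by
    rw [Matrix.det_kronecker, Matrix.det_one, one_pow, mul_one]
    exact pow_ne_zero _ (det_fourier_ne_zero hψ)
  have h2 := mul_left_cancel₀ hne h
  rw [← RingHom.mapMatrix_apply, ← RingHom.map_det, eq_intCast] at h2
  rw [h2]
  refine Finset.prod_congr rfl fun k _ => ?_
  rw [RingHom.map_det, RingHom.mapMatrix_apply]

/-! ### The subring fixed by `x ↦ x⁴` -/

namespace CyclicRing11

/-- The powers `xᵈ` of the generator of `ℤ[ℤ/11]`. -/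
noncomputable def mon (d : ZMod 11) : CyclicRing11 := .single d 1

/-- The element of `ℤ[ℤ/11]` with coefficients `p` at `0`, `q` at the nonzero squares and `r` at
the non-squares. -/
noncomputable def periodElement (p q r : ℤ) : CyclicRing11 :=
  p + q * (mon 1 + mon 3 + mon 4 + mon 5 + mon 9)
    + r * (mon 2 + mon 6 + mon 7 + mon 8 + mon 10)

theorem evalChar_mon {A : Type*} [CommRing A] (ψ : AddChar (ZMod 11) A) (d : ZMod 11) :
    evalChar ψ (mon d) = ψ d := by
  simp [mon, evalChar_single]

theorem evalChar_periodElement {A : Type*} [CommRing A] (ψ : AddChar (ZMod 11) A) (p q r : ℤ) :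
    evalChar ψ (periodElement p q r) = p + q * (ψ 1 + ψ 3 + ψ 4 + ψ 5 + ψ 9)
    + r * (ψ 2 + ψ 6 + ψ 7 + ψ 8 + ψ 10) := by
  simp only [periodElement, map_add, map_mul, map_intCast, evalChar_mon]

theorem eq_sum_mon (P : CyclicRing11) : P = ∑ d, (P.coeff d : CyclicRing11) * mon d := by
  ext d
  simp [AddMonoidAlgebra.coeff_sum, mon, ← zsmul_eq_mul]

theorem eq_periodElement_of_powMap_eq {P : CyclicRing11} (h : powMap 3 P = P) :
    P = periodElement (P.coeff 0) (P.coeff 1) (P.coeff 2) := by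
  have hc : ∀ d : ZMod 11, P.coeff (4 * d) = P.coeff d := by
    intro d
    conv_rhs => rw [← h, coeff_powMap 3 4 (by decide)]
  have h4 : P.coeff 4 = P.coeff 1 := hc 1
  have h5 : P.coeff 5 = P.coeff 1 := (hc 4).trans h4
  have h9 : P.coeff 9 = P.coeff 1 := (hc 5).trans h5
  have h3 : P.coeff 3 = P.coeff 1 := (hc 9).trans h9
  have h8 : P.coeff 8 = P.coeff 2 := hc 2
  have h10 : P.coeff 10 = P.coeff 2 := (hc 8).trans h8
  have h7 : P.coeff 7 = P.coeff 2 := (hc 10).trans h10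
  have h6 : P.coeff 6 = P.coeff 2 := (hc 7).trans h7
  have h0 : mon 0 = 1 := rfl
  conv_lhs => rw [eq_sum_mon P, ZMod.sum_univ_eleven, h3, h4, h5, h6, h7,
     h8, h9, h10, h0]
  rw [periodElement]
  ring

end CyclicRing11

theorem powMap_det_twistedCirculant (f : ZMod 5 → CyclicRing11) :
    powMap 3 (twistedCirculant f).det = (twistedCirculant f).det := by
  rw [RingHom.map_det]
  conv_rhs => rw [← Matrix.det_submatrix_equiv_self (Equiv.addRight (1 : ZMod 5))]
  refine congrArg Matrix.det ?_
  ext1 i j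
  have h : ∀ i : ZMod 5, (3 : ZMod 11) * 3 ^ i.val = 3 ^ (i + 1).val := by decide
  simp only [RingHom.mapMatrix_apply, Matrix.map_apply, twistedCirculant, Matrix.of_apply,
    Matrix.submatrix_apply, Equiv.coe_addRight, add_sub_add_right_eq_sub, powMap_powMap, h]

theorem prod_evalChar_periodElement {ψ : AddChar (ZMod 11) ℂ} (hψ : ψ.IsPrimitive) (p q r : ℤ) :
    ∏ k, evalChar (ψ.mulShift k) (periodElement p q r) = (((p + 5 * q + 5 * r) *
      (p ^ 2 - p * q - p * r + 3 * q ^ 2 + 3 * r ^ 2 - 5 * q * r) ^ 5 : ℤ) : ℂ) := by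
  have hsum := AddChar.sum_mulShift 1 hψ
  rw [ZMod.sum_univ_eleven, if_neg (by decide)] at hsum
  simp only [mul_one] at hsum
  set s := ψ 1 + ψ 3 + ψ 4 + ψ 5 + ψ 9 with hsdef
  set t := ψ 2 + ψ 6 + ψ 7 + ψ 8 + ψ 10 with htdef
  have h0 : ψ 0 = 1 := AddChar.map_zero_eq_one ψ
  have hst : s + t = -1 := by
    linear_combination hsum - h0
  have hpow : ∀ n : ℕ, ψ n = ψ 1 ^ n := by
    intro n
    rw [← AddChar.map_nsmul_eq_pow, nsmul_one]
  have hx : ψ 1 ^ 11 = 1 := by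
    rw [← hpow, ← h0]
    rfl
  have h2 : ψ 2 = ψ 1 ^ 2 := hpow 2
  have h3 : ψ 3 = ψ 1 ^ 3 := hpow 3
  have h4 : ψ 4 = ψ 1 ^ 4 := hpow 4
  have h5 : ψ 5 = ψ 1 ^ 5 := hpow 5
  have h6 : ψ 6 = ψ 1 ^ 6 := hpow 6
  have h7 : ψ 7 = ψ 1 ^ 7 := hpow 7
  have h8 : ψ 8 = ψ 1 ^ 8 := hpow 8
  have h9 : ψ 9 = ψ 1 ^ 9 := hpow 9
  have h10 : ψ 10 = ψ 1 ^ 10 := hpow 10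
  have hprod : s * t = 3 := by
    have e : s * t = 5 + 2 * (s + t) := by
      rw [hsdef, htdef, h2, h3, h4, h5, h6, h7, h8, h9, h10]
      generalize ψ 1 = x at hx
      linear_combination (5 + 2 * x + 2 * x ^ 2 + x ^ 3 + 2 * x ^ 4 + x ^ 5 + x ^ 6 + x ^ 8) * hx
    rw [e, hst]
    norm_num
  have hsq : ∀ k : ZMod 11, k = 1 ∨ k = 3 ∨ k = 4 ∨ k = 5 ∨ k = 9 →
      evalChar (ψ.mulShift k) (periodElement p q r) = p + q * s + r * t := by
    rintro k (rfl | rfl | rfl | rfl | rfl) <;> rw [evalChar_periodElement, hsdef, htdef] <;>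
      simp only [AddChar.mulShift_apply] <;> reduce_mod_char <;> ring
  have hnsq : ∀ k : ZMod 11, k = 2 ∨ k = 6 ∨ k = 7 ∨ k = 8 ∨ k = 10 →
      evalChar (ψ.mulShift k) (periodElement p q r) = p + q * t + r * s := by
    rintro k (rfl | rfl | rfl | rfl | rfl) <;> rw [evalChar_periodElement, hsdef, htdef] <;>
      simp only [AddChar.mulShift_apply] <;> reduce_mod_char <;> ring
  have hzero : evalChar (ψ.mulShift 0) (periodElement p q r) = p + 5 * q + 5 * r := by
    rw [evalChar_periodElement]
    simp only [AddChar.mulShift_apply, zero_mul, h0]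
    ring
  have hnorm : (p + q * s + r * t) * (p + q * t + r * s) =
      (p ^ 2 - p * q - p * r + 3 * q ^ 2 + 3 * r ^ 2 - 5 * q * r : ℂ) := by
    have ht : t = -1 - s := by linear_combination hst
    rw [ht] at hprod ⊢
    linear_combination (q ^ 2 + r ^ 2 - 2 * q * r : ℂ) * hprod
  rw [ZMod.prod_univ_eleven, hzero, hsq 1 (by simp), hnsq 2 (by simp), hsq 3 (by simp),
    hsq 4 (by simp), hsq 5 (by simp), hnsq 6 (by simp), hnsq 7 (by simp), hnsq 8 (by simp),
    hsq 9 (by simp), hnsq 10 (by simp)]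
  push_cast
  rw [← hnorm]
  generalize (p + q * s + r * t : ℂ) = u
  generalize (p + q * t + r * s : ℂ) = v
  ring

/-- The group determinant in terms of the coefficients of the determinant over `ℤ[ℤ/11]`. -/
theorem det_leftMulMatrix55_eq {f : ZMod 5 → CyclicRing11} {p q r : ℤ}
    (h : (twistedCirculant f).det = periodElement p q r) :
    (leftMulMatrix55 f).det = (p + 5 * q + 5 * r) *
      (p ^ 2 - p * q - p * r + 3 * q ^ 2 + 3 * r ^ 2 - 5 * q * r) ^ 5 := by
  have hψ : (ZMod.stdAddChar (N := 11)).IsPrimitive := ZMod.isPrimitive_stdAddChar 11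
  have h2 := det_leftMulMatrix55 hψ f
  rw [h, prod_evalChar_periodElement hψ] at h2
  exact_mod_cast h2

/-! ### Determinants of size 5 -/

theorem Matrix.det_fin_four {R : Type*} [CommRing R] (M : Matrix (Fin 4) (Fin 4) R) :
    M.det =
      M 0 0 * (M 1 1 * M 2 2 * M 3 3 - M 1 1 * M 2 3 * M 3 2 - M 1 2 * M 2 1 * M 3 3 + M 1 2 * M 2
      3 * M 3 1 + M 1 3 * M 2 1 * M 3 2 - M 1 3 * M 2 2 * M 3 1) - M 0 1 * (M 1 0 * M 2 2 * M 3 3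
      - M 1 0 * M 2 3 * M 3 2 - M 1 2 * M 2 0 * M 3 3 + M 1 2 * M 2 3 * M 3 0 + M 1 3 * M 2 0 * M
      3 2 - M 1 3 * M 2 2 * M 3 0) + M 0 2 * (M 1 0 * M 2 1 * M 3 3 - M 1 0 * M 2 3 * M 3 1 - M 1
      1 * M 2 0 * M 3 3 + M 1 1 * M 2 3 * M 3 0 + M 1 3 * M 2 0 * M 3 1 - M 1 3 * M 2 1 * M 3 0) -
      M 0 3 * (M 1 0 * M 2 1 * M 3 2 - M 1 0 * M 2 2 * M 3 1 - M 1 1 * M 2 0 * M 3 2 + M 1 1 * M 2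
      2 * M 3 0 + M 1 2 * M 2 0 * M 3 1 - M 1 2 * M 2 1 * M 3 0) := by
  rw [Matrix.det_succ_row_zero]
  simp only [Fin.sum_univ_four, Matrix.det_fin_three, Matrix.submatrix_apply]
  simp [Fin.succAbove]
  ring

theorem Matrix.det_zmod_five {R : Type*} [CommRing R] (M : Matrix (ZMod 5) (ZMod 5) R) :
    M.det =
      M 0 0 * (M 1 1 * (M 2 2 * M 3 3 * M 4 4 - M 2 2 * M 3 4 * M 4 3 - M 2 3 * M 3 2 * M 4 4 + M
      2 3 * M 3 4 * M 4 2 + M 2 4 * M 3 2 * M 4 3 - M 2 4 * M 3 3 * M 4 2) - M 1 2 * (M 2 1 * M 3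
      3 * M 4 4 - M 2 1 * M 3 4 * M 4 3 - M 2 3 * M 3 1 * M 4 4 + M 2 3 * M 3 4 * M 4 1 + M 2 4 *
      M 3 1 * M 4 3 - M 2 4 * M 3 3 * M 4 1) + M 1 3 * (M 2 1 * M 3 2 * M 4 4 - M 2 1 * M 3 4 * M
      4 2 - M 2 2 * M 3 1 * M 4 4 + M 2 2 * M 3 4 * M 4 1 + M 2 4 * M 3 1 * M 4 2 - M 2 4 * M 3 2
      * M 4 1) - M 1 4 * (M 2 1 * M 3 2 * M 4 3 - M 2 1 * M 3 3 * M 4 2 - M 2 2 * M 3 1 * M 4 3 +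
      M 2 2 * M 3 3 * M 4 1 + M 2 3 * M 3 1 * M 4 2 - M 2 3 * M 3 2 * M 4 1)) - M 0 1 * (M 1 0 *
      (M 2 2 * M 3 3 * M 4 4 - M 2 2 * M 3 4 * M 4 3 - M 2 3 * M 3 2 * M 4 4 + M 2 3 * M 3 4 * M 4
      2 + M 2 4 * M 3 2 * M 4 3 - M 2 4 * M 3 3 * M 4 2) - M 1 2 * (M 2 0 * M 3 3 * M 4 4 - M 2 0
      * M 3 4 * M 4 3 - M 2 3 * M 3 0 * M 4 4 + M 2 3 * M 3 4 * M 4 0 + M 2 4 * M 3 0 * M 4 3 - M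
      2 4 * M 3 3 * M 4 0) + M 1 3 * (M 2 0 * M 3 2 * M 4 4 - M 2 0 * M 3 4 * M 4 2 - M 2 2 * M 3
      0 * M 4 4 + M 2 2 * M 3 4 * M 4 0 + M 2 4 * M 3 0 * M 4 2 - M 2 4 * M 3 2 * M 4 0) - M 1 4 *
      (M 2 0 * M 3 2 * M 4 3 - M 2 0 * M 3 3 * M 4 2 - M 2 2 * M 3 0 * M 4 3 + M 2 2 * M 3 3 * M 4
      0 + M 2 3 * M 3 0 * M 4 2 - M 2 3 * M 3 2 * M 4 0)) + M 0 2 * (M 1 0 * (M 2 1 * M 3 3 * M 4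
      4 - M 2 1 * M 3 4 * M 4 3 - M 2 3 * M 3 1 * M 4 4 + M 2 3 * M 3 4 * M 4 1 + M 2 4 * M 3 1 *
      M 4 3 - M 2 4 * M 3 3 * M 4 1) - M 1 1 * (M 2 0 * M 3 3 * M 4 4 - M 2 0 * M 3 4 * M 4 3 - M
      2 3 * M 3 0 * M 4 4 + M 2 3 * M 3 4 * M 4 0 + M 2 4 * M 3 0 * M 4 3 - M 2 4 * M 3 3 * M 4 0)
      + M 1 3 * (M 2 0 * M 3 1 * M 4 4 - M 2 0 * M 3 4 * M 4 1 - M 2 1 * M 3 0 * M 4 4 + M 2 1 * M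
      3 4 * M 4 0 + M 2 4 * M 3 0 * M 4 1 - M 2 4 * M 3 1 * M 4 0) - M 1 4 * (M 2 0 * M 3 1 * M 4
      3 - M 2 0 * M 3 3 * M 4 1 - M 2 1 * M 3 0 * M 4 3 + M 2 1 * M 3 3 * M 4 0 + M 2 3 * M 3 0 *
      M 4 1 - M 2 3 * M 3 1 * M 4 0)) - M 0 3 * (M 1 0 * (M 2 1 * M 3 2 * M 4 4 - M 2 1 * M 3 4 *
      M 4 2 - M 2 2 * M 3 1 * M 4 4 + M 2 2 * M 3 4 * M 4 1 + M 2 4 * M 3 1 * M 4 2 - M 2 4 * M 3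
      2 * M 4 1) - M 1 1 * (M 2 0 * M 3 2 * M 4 4 - M 2 0 * M 3 4 * M 4 2 - M 2 2 * M 3 0 * M 4 4
      + M 2 2 * M 3 4 * M 4 0 + M 2 4 * M 3 0 * M 4 2 - M 2 4 * M 3 2 * M 4 0) + M 1 2 * (M 2 0 *
      M 3 1 * M 4 4 - M 2 0 * M 3 4 * M 4 1 - M 2 1 * M 3 0 * M 4 4 + M 2 1 * M 3 4 * M 4 0 + M 2
      4 * M 3 0 * M 4 1 - M 2 4 * M 3 1 * M 4 0) - M 1 4 * (M 2 0 * M 3 1 * M 4 2 - M 2 0 * M 3 2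
      * M 4 1 - M 2 1 * M 3 0 * M 4 2 + M 2 1 * M 3 2 * M 4 0 + M 2 2 * M 3 0 * M 4 1 - M 2 2 * M
      3 1 * M 4 0)) + M 0 4 * (M 1 0 * (M 2 1 * M 3 2 * M 4 3 - M 2 1 * M 3 3 * M 4 2 - M 2 2 * M
      3 1 * M 4 3 + M 2 2 * M 3 3 * M 4 1 + M 2 3 * M 3 1 * M 4 2 - M 2 3 * M 3 2 * M 4 1) - M 1 1
      * (M 2 0 * M 3 2 * M 4 3 - M 2 0 * M 3 3 * M 4 2 - M 2 2 * M 3 0 * M 4 3 + M 2 2 * M 3 3 * M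
      4 0 + M 2 3 * M 3 0 * M 4 2 - M 2 3 * M 3 2 * M 4 0) + M 1 2 * (M 2 0 * M 3 1 * M 4 3 - M 2
      0 * M 3 3 * M 4 1 - M 2 1 * M 3 0 * M 4 3 + M 2 1 * M 3 3 * M 4 0 + M 2 3 * M 3 0 * M 4 1 -
      M 2 3 * M 3 1 * M 4 0) - M 1 3 * (M 2 0 * M 3 1 * M 4 2 - M 2 0 * M 3 2 * M 4 1 - M 2 1 * M
      3 0 * M 4 2 + M 2 1 * M 3 2 * M 4 0 + M 2 2 * M 3 0 * M 4 1 - M 2 2 * M 3 1 * M 4 0)) := by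
  have h : ∀ M : Matrix (Fin 5) (Fin 5) R, M.det =
      M 0 0 * (M 1 1 * (M 2 2 * M 3 3 * M 4 4 - M 2 2 * M 3 4 * M 4 3 - M 2 3 * M 3 2 * M 4 4 + M
      2 3 * M 3 4 * M 4 2 + M 2 4 * M 3 2 * M 4 3 - M 2 4 * M 3 3 * M 4 2) - M 1 2 * (M 2 1 * M 3
      3 * M 4 4 - M 2 1 * M 3 4 * M 4 3 - M 2 3 * M 3 1 * M 4 4 + M 2 3 * M 3 4 * M 4 1 + M 2 4 *
      M 3 1 * M 4 3 - M 2 4 * M 3 3 * M 4 1) + M 1 3 * (M 2 1 * M 3 2 * M 4 4 - M 2 1 * M 3 4 * M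
      4 2 - M 2 2 * M 3 1 * M 4 4 + M 2 2 * M 3 4 * M 4 1 + M 2 4 * M 3 1 * M 4 2 - M 2 4 * M 3 2
      * M 4 1) - M 1 4 * (M 2 1 * M 3 2 * M 4 3 - M 2 1 * M 3 3 * M 4 2 - M 2 2 * M 3 1 * M 4 3 +
      M 2 2 * M 3 3 * M 4 1 + M 2 3 * M 3 1 * M 4 2 - M 2 3 * M 3 2 * M 4 1)) - M 0 1 * (M 1 0 *
      (M 2 2 * M 3 3 * M 4 4 - M 2 2 * M 3 4 * M 4 3 - M 2 3 * M 3 2 * M 4 4 + M 2 3 * M 3 4 * M 4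
      2 + M 2 4 * M 3 2 * M 4 3 - M 2 4 * M 3 3 * M 4 2) - M 1 2 * (M 2 0 * M 3 3 * M 4 4 - M 2 0
      * M 3 4 * M 4 3 - M 2 3 * M 3 0 * M 4 4 + M 2 3 * M 3 4 * M 4 0 + M 2 4 * M 3 0 * M 4 3 - M
      2 4 * M 3 3 * M 4 0) + M 1 3 * (M 2 0 * M 3 2 * M 4 4 - M 2 0 * M 3 4 * M 4 2 - M 2 2 * M 3
      0 * M 4 4 + M 2 2 * M 3 4 * M 4 0 + M 2 4 * M 3 0 * M 4 2 - M 2 4 * M 3 2 * M 4 0) - M 1 4 *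
      (M 2 0 * M 3 2 * M 4 3 - M 2 0 * M 3 3 * M 4 2 - M 2 2 * M 3 0 * M 4 3 + M 2 2 * M 3 3 * M 4
      0 + M 2 3 * M 3 0 * M 4 2 - M 2 3 * M 3 2 * M 4 0)) + M 0 2 * (M 1 0 * (M 2 1 * M 3 3 * M 4
      4 - M 2 1 * M 3 4 * M 4 3 - M 2 3 * M 3 1 * M 4 4 + M 2 3 * M 3 4 * M 4 1 + M 2 4 * M 3 1 *
      M 4 3 - M 2 4 * M 3 3 * M 4 1) - M 1 1 * (M 2 0 * M 3 3 * M 4 4 - M 2 0 * M 3 4 * M 4 3 - M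
      2 3 * M 3 0 * M 4 4 + M 2 3 * M 3 4 * M 4 0 + M 2 4 * M 3 0 * M 4 3 - M 2 4 * M 3 3 * M 4 0)
      + M 1 3 * (M 2 0 * M 3 1 * M 4 4 - M 2 0 * M 3 4 * M 4 1 - M 2 1 * M 3 0 * M 4 4 + M 2 1 * M
      3 4 * M 4 0 + M 2 4 * M 3 0 * M 4 1 - M 2 4 * M 3 1 * M 4 0) - M 1 4 * (M 2 0 * M 3 1 * M 4
      3 - M 2 0 * M 3 3 * M 4 1 - M 2 1 * M 3 0 * M 4 3 + M 2 1 * M 3 3 * M 4 0 + M 2 3 * M 3 0 *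
      M 4 1 - M 2 3 * M 3 1 * M 4 0)) - M 0 3 * (M 1 0 * (M 2 1 * M 3 2 * M 4 4 - M 2 1 * M 3 4 *
      M 4 2 - M 2 2 * M 3 1 * M 4 4 + M 2 2 * M 3 4 * M 4 1 + M 2 4 * M 3 1 * M 4 2 - M 2 4 * M 3
      2 * M 4 1) - M 1 1 * (M 2 0 * M 3 2 * M 4 4 - M 2 0 * M 3 4 * M 4 2 - M 2 2 * M 3 0 * M 4 4
      + M 2 2 * M 3 4 * M 4 0 + M 2 4 * M 3 0 * M 4 2 - M 2 4 * M 3 2 * M 4 0) + M 1 2 * (M 2 0 *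
      M 3 1 * M 4 4 - M 2 0 * M 3 4 * M 4 1 - M 2 1 * M 3 0 * M 4 4 + M 2 1 * M 3 4 * M 4 0 + M 2
      4 * M 3 0 * M 4 1 - M 2 4 * M 3 1 * M 4 0) - M 1 4 * (M 2 0 * M 3 1 * M 4 2 - M 2 0 * M 3 2
      * M 4 1 - M 2 1 * M 3 0 * M 4 2 + M 2 1 * M 3 2 * M 4 0 + M 2 2 * M 3 0 * M 4 1 - M 2 2 * M
      3 1 * M 4 0)) + M 0 4 * (M 1 0 * (M 2 1 * M 3 2 * M 4 3 - M 2 1 * M 3 3 * M 4 2 - M 2 2 * M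
      3 1 * M 4 3 + M 2 2 * M 3 3 * M 4 1 + M 2 3 * M 3 1 * M 4 2 - M 2 3 * M 3 2 * M 4 1) - M 1 1
      * (M 2 0 * M 3 2 * M 4 3 - M 2 0 * M 3 3 * M 4 2 - M 2 2 * M 3 0 * M 4 3 + M 2 2 * M 3 3 * M
      4 0 + M 2 3 * M 3 0 * M 4 2 - M 2 3 * M 3 2 * M 4 0) + M 1 2 * (M 2 0 * M 3 1 * M 4 3 - M 2
      0 * M 3 3 * M 4 1 - M 2 1 * M 3 0 * M 4 3 + M 2 1 * M 3 3 * M 4 0 + M 2 3 * M 3 0 * M 4 1 -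
      M 2 3 * M 3 1 * M 4 0) - M 1 3 * (M 2 0 * M 3 1 * M 4 2 - M 2 0 * M 3 2 * M 4 1 - M 2 1 * M
      3 0 * M 4 2 + M 2 1 * M 3 2 * M 4 0 + M 2 2 * M 3 0 * M 4 1 - M 2 2 * M 3 1 * M 4 0)) := by
    intro M
    rw [Matrix.det_succ_row_zero]
    simp only [Fin.sum_univ_five, Matrix.det_fin_four, Matrix.submatrix_apply]
    simp [Fin.succAbove]
    ring
  exact h M

/-! ### Necessary conditions -/

theorem det_circulant_five (v : ZMod 5 → ℤ) :
    ∃ q : ℤ, (Matrix.of fun i j : ZMod 5 => v (i - j)).det =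
      (v 0 + v 1 + v 2 + v 3 + v 4) * ((v 0 + v 1 + v 2 + v 3 + v 4) ^ 4 + 5 * q) := by
  rw [Matrix.det_zmod_five]
  simp only [Matrix.of_apply]
  reduce_mod_char
  generalize v 0 = a
  generalize v 1 = b
  generalize v 2 = c
  generalize v 3 = d
  generalize v 4 = e
  refine ⟨- a ^ 3 * b - a ^ 3 * c - a ^ 3 * d - a ^ 3 * e - a ^ 2 * b ^ 2 - 2 * a ^ 2 * b * c - 2 * a
      ^ 2 * b * d - 3 * a ^ 2 * b * e - a ^ 2 * c ^ 2 - 3 * a ^ 2 * c * d - 2 * a ^ 2 * c * e - a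
      ^ 2 * d ^ 2 - 2 * a ^ 2 * d * e - a ^ 2 * e ^ 2 - a * b ^ 3 - 3 * a * b ^ 2 * c - 2 * a * b
      ^ 2 * d - 2 * a * b ^ 2 * e - 2 * a * b * c ^ 2 - 5 * a * b * c * d - 5 * a * b * c * e - 3
      * a * b * d ^ 2 - 5 * a * b * d * e - 2 * a * b * e ^ 2 - a * c ^ 3 - 2 * a * c ^ 2 * d - 3
      * a * c ^ 2 * e - 2 * a * c * d ^ 2 - 5 * a * c * d * e - 2 * a * c * e ^ 2 - a * d ^ 3 - 2
      * a * d ^ 2 * e - 3 * a * d * e ^ 2 - a * e ^ 3 - b ^ 3 * c - b ^ 3 * d - b ^ 3 * e - b ^ 2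
      * c ^ 2 - 2 * b ^ 2 * c * d - 2 * b ^ 2 * c * e - b ^ 2 * d ^ 2 - 3 * b ^ 2 * d * e - b ^ 2
      * e ^ 2 - b * c ^ 3 - 3 * b * c ^ 2 * d - 2 * b * c ^ 2 * e - 2 * b * c * d ^ 2 - 5 * b * c
      * d * e - 3 * b * c * e ^ 2 - b * d ^ 3 - 2 * b * d ^ 2 * e - 2 * b * d * e ^ 2 - b * e ^ 3
      - c ^ 3 * d - c ^ 3 * e - c ^ 2 * d ^ 2 - 2 * c ^ 2 * d * e - c ^ 2 * e ^ 2 - c * d ^ 3 - 3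
      * c * d ^ 2 * e - 2 * c * d * e ^ 2 - c * e ^ 3 - d ^ 3 * e - d ^ 2 * e ^ 2 - d * e ^ 3, ?_⟩
  ring

theorem det_circulant_five_dvd (v : ZMod 5 → ℤ) :
    ¬ (5 : ℤ) ∣ (Matrix.of fun i j : ZMod 5 => v (i - j)).det ∨
      (25 : ℤ) ∣ (Matrix.of fun i j : ZMod 5 => v (i - j)).det := by
  obtain ⟨q, hq⟩ := det_circulant_five v
  rw [hq]
  generalize v 0 + v 1 + v 2 + v 3 + v 4 = s
  refine or_iff_not_imp_left.2 fun h => ?_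
  rw [not_not] at h
  have h5 : (5 : ℤ) ∣ s ^ 5 := by
    have h2 := dvd_sub h (Dvd.intro (s * q) rfl : (5 : ℤ) ∣ 5 * (s * q))
    ring_nf at h2
    exact h2
  obtain ⟨t, rfl⟩ := Int.Prime.dvd_pow' (by norm_num : Nat.Prime 5) h5
  exact ⟨t * (125 * t ^ 4 + q), by push_cast; ring⟩

/-- The determinant over `ℤ[ℤ/11]` has constant coefficients on the orbits of `d ↦ 4 d`, and
its augmentation is a circulant determinant. -/
theorem det_twistedCirculant_eq (f : ZMod 5 → CyclicRing11) :
    ∃ p q r : ℤ, (twistedCirculant f).det = periodElement p q r ∧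
      (¬ (5 : ℤ) ∣ p + 5 * q + 5 * r ∨ (25 : ℤ) ∣ p + 5 * q + 5 * r) := by
  have h := eq_periodElement_of_powMap_eq (powMap_det_twistedCirculant f)
  refine ⟨_, _, _, h, ?_⟩
  generalize (twistedCirculant f).det.coeff 0 = p at h ⊢
  generalize (twistedCirculant f).det.coeff 1 = q at h ⊢
  generalize (twistedCirculant f).det.coeff 2 = r at h ⊢
  have haug : p + 5 * q + 5 * r =
      (Matrix.of fun i j : ZMod 5 => evalChar (1 : AddChar (ZMod 11) ℤ) (f (i - j))).det := by
    have h2 := congrArg (evalChar (1 : AddChar (ZMod 11) ℤ)) h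
    rw [RingHom.map_det, evalChar_periodElement] at h2
    have h3 : (evalChar (1 : AddChar (ZMod 11) ℤ)).mapMatrix (twistedCirculant f) =
        Matrix.of fun i j : ZMod 5 => evalChar (1 : AddChar (ZMod 11) ℤ) (f (i - j)) := by
      ext i j
      have h4 : ∀ (c : ZMod 11) (s : CyclicRing11),
          evalChar (1 : AddChar (ZMod 11) ℤ) (powMap c s) = evalChar 1 s := by
        intro c s
        rw [eq_sum_mon s]
        simp [mon, powMap_single, evalChar_single]
      simp [twistedCirculant, h4]
    rw [h3] at h2
    rw [h2]
    simp only [AddChar.one_apply, Int.cast_id]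
    ring
  rw [haug]
  exact det_circulant_five_dvd fun k => evalChar 1 (f k)

theorem det_leftMulMatrix55_mem (f : ZMod 5 → CyclicRing11) :
    ∃ m α β : ℤ, (¬ (5 : ℤ) ∣ m ∨ (25 : ℤ) ∣ m) ∧
      (((leftMulMatrix55 f).det : ℤ) : ℚ) = (m : ℚ) * (Algebra.norm ℚ
        ((m : QuadField11) + 11 * (α : QuadField11)
          + (1 / 2) * (11 + iSqrt11) * (β : QuadField11))) ^ 5 := by
  obtain ⟨p, q, r, h, hm⟩ := det_twistedCirculant_eq f
  refine ⟨p + 5 * q + 5 * r, -q, q - r, hm, ?_⟩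
  rw [norm_quadField11_integer, det_leftMulMatrix55_eq h]
  push_cast
  ring

/-! ### Realising the values -/

namespace CyclicRing11

theorem powMap_mon (c d : ZMod 11) : powMap c (mon d) = mon (c * d) := powMap_single _ _ _

theorem mon_natCast (n : ℕ) : mon n = mon 1 ^ n := by
  simp [mon, AddMonoidAlgebra.single_pow]

theorem powMap_one (r : CyclicRing11) : powMap 1 r = r := by
  rw [eq_sum_mon r]
  simp [powMap_mon]

end CyclicRing11

/-- The coefficients of `Y + v(X) + g(X) (1 + Y + Y² + Y³ + Y⁴)`. -/
noncomputable def perturbedCoeffs (v g : CyclicRing11) (k : ZMod 5) : CyclicRing11 :=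
  (if k = 0 then v else if k = 1 then 1 else 0) + g

theorem det_twistedCirculant_perturbedCoeffs (v g : CyclicRing11) :
    (twistedCirculant (perturbedCoeffs v g)).det =
      1 + v * powMap 3 v * powMap 9 v * powMap 5 v * powMap 4 v
      + (g * (1 - powMap 4 v + powMap 4 v * powMap 5 v - powMap 4 v * powMap 5 v * powMap 9 v
          + powMap 4 v * powMap 5 v * powMap 9 v * powMap 3 v)
        + powMap 3 g * (1 - v + v * powMap 4 v - v * powMap 4 v * powMap 5 v
          + v * powMap 4 v * powMap 5 v * powMap 9 v)
        + powMap 9 g * (1 - powMap 3 v + powMap 3 v * v - powMap 3 v * v * powMap 4 v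
          + powMap 3 v * v * powMap 4 v * powMap 5 v)
        + powMap 5 g * (1 - powMap 9 v + powMap 9 v * powMap 3 v - powMap 9 v * powMap 3 v * v
          + powMap 9 v * powMap 3 v * v * powMap 4 v)
        + powMap 4 g * (1 - powMap 5 v + powMap 5 v * powMap 9 v
          - powMap 5 v * powMap 9 v * powMap 3 v
          + powMap 5 v * powMap 9 v * powMap 3 v * v)) := by
  have e : ∀ i j : ZMod 5, twistedCirculant (perturbedCoeffs v g) i j =
      (if i - j = 0 then powMap (3 ^ i.val) v else if i - j = 1 then 1 else 0)
        + powMap (3 ^ i.val) g := by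
    intro i j
    change powMap _ ((if i - j = 0 then v else if i - j = 1 then 1 else 0) + g) = _
    rw [map_add]
    split_ifs <;> simp
  have p0 : (3 : ZMod 11) ^ (0 : ZMod 5).val = 1 := rfl
  have p1 : (3 : ZMod 11) ^ (1 : ZMod 5).val = 3 := rfl
  have p2 : (3 : ZMod 11) ^ (2 : ZMod 5).val = 9 := rfl
  have p3 : (3 : ZMod 11) ^ (3 : ZMod 5).val = 5 := rfl
  have p4 : (3 : ZMod 11) ^ (4 : ZMod 5).val = 4 := rfl
  rw [Matrix.det_zmod_five]
  simp +decide only [e, p0, p1, p2, p3, p4, powMap_one, if_true, if_false]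
  generalize powMap 3 v = v1
  generalize powMap 9 v = v2
  generalize powMap 5 v = v3
  generalize powMap 4 v = v4
  generalize powMap 3 g = g1
  generalize powMap 9 g = g2
  generalize powMap 5 g = g3
  generalize powMap 4 g = g4
  ring

theorem exists_det_eq_periodElement_of_one (a b c : ℤ) :
    ∃ f, (twistedCirculant f).det = periodElement (1 + 5 * a) b c := by
  refine ⟨perturbedCoeffs 0 (a + b * mon 1 + c * mon 2), ?_⟩
  rw [det_twistedCirculant_perturbedCoeffs]
  simp only [map_add, map_mul, map_zero, map_intCast, powMap_mon, periodElement]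
  reduce_mod_char
  push_cast
  ring

theorem exists_det_eq_periodElement_of_two (a b c : ℤ) :
    ∃ f, (twistedCirculant f).det = periodElement (2 + 5 * a) b c := by
  refine ⟨perturbedCoeffs 1 (a + b * mon 1 + c * mon 2), ?_⟩
  rw [det_twistedCirculant_perturbedCoeffs]
  simp only [map_add, map_mul, map_one, map_intCast, powMap_mon, periodElement]
  reduce_mod_char
  push_cast
  ring

theorem exists_det_eq_periodElement_of_dvd (a b c : ℤ) :
    ∃ f, (twistedCirculant f).det =
      periodElement (5 + 5 * c) (-1 + 5 * a + 4 * b + 4 * c) b := by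
  refine ⟨perturbedCoeffs (mon 1 - mon 2 - mon 8) (a * mon 4 + b * mon 2 + c * mon 5), ?_⟩
  rw [det_twistedCirculant_perturbedCoeffs]
  have hx : mon 1 ^ 11 = 1 := by
    rw [← mon_natCast]
    rfl
  have h2 : mon 2 = mon 1 ^ 2 := mon_natCast 2
  have h3 : mon 3 = mon 1 ^ 3 := mon_natCast 3
  have h4 : mon 4 = mon 1 ^ 4 := mon_natCast 4
  have h5 : mon 5 = mon 1 ^ 5 := mon_natCast 5
  have h6 : mon 6 = mon 1 ^ 6 := mon_natCast 6
  have h7 : mon 7 = mon 1 ^ 7 := mon_natCast 7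
  have h8 : mon 8 = mon 1 ^ 8 := mon_natCast 8
  have h9 : mon 9 = mon 1 ^ 9 := mon_natCast 9
  have h10 : mon 10 = mon 1 ^ 10 := mon_natCast 10
  obtain ⟨v, hv⟩ : ∃ v, v = mon 1 - mon 2 - mon 8 := ⟨_, rfl⟩
  have hv1 : powMap 3 v = mon 3 - mon 6 - mon 2 := by
    rw [hv]
    simp only [map_sub, powMap_mon]
    rfl
  have hv2 : powMap 9 v = mon 9 - mon 7 - mon 6 := by
    rw [hv]
    simp only [map_sub, powMap_mon]
    rfl
  have hv3 : powMap 5 v = mon 5 - mon 10 - mon 7 := by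
    rw [hv]
    simp only [map_sub, powMap_mon]
    rfl
  have hv4 : powMap 4 v = mon 4 - mon 8 - mon 10 := by
    rw [hv]
    simp only [map_sub, powMap_mon]
    rfl
  have hN : v * powMap 3 v * powMap 9 v * powMap 5 v * powMap 4 v =
      4 - (mon 1 + mon 3 + mon 4 + mon 5 + mon 9) := by
    rw [hv1, hv2, hv3, hv4, hv, h2, h3, h4, h5, h6, h7, h8, h9, h10]
    generalize mon 1 = x at hx
    linear_combination (4 - x - x ^ 3 - x ^ 4 - x ^ 5 - x ^ 9 + 4 * x ^ 11 - x ^ 12 - x ^ 14 - x ^ 15 - x ^ 16 - x ^ 18 + x ^ 19 + x ^ 20 - x ^ 21 + x ^ 22 + 2 * x ^ 24 - x ^ 25 - x ^ 26 - 2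
        * x ^ 27 - x ^ 29 + x ^ 32) * hx
  have hw : 1 - powMap 4 v + powMap 4 v * powMap 5 v - powMap 4 v * powMap 5 v * powMap 9 v
      + powMap 4 v * powMap 5 v * powMap 9 v * powMap 3 v =
      2 + mon 1 - mon 4 - mon 5 + mon 6 + 3 * mon 10 := by
    rw [hv1, hv2, hv3, hv4, h4, h5, h6, h7, h8, h9, h10, h2, h3]
    generalize mon 1 = x at hx
    linear_combination (1 + x - x ^ 5 + x ^ 6 - x ^ 8 - x ^ 9 + 2 * x ^ 10 + 2 * x ^ 11 + x ^ 12 + x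
        ^ 13 + x ^ 14 - x ^ 15 - 2 * x ^ 16 + x ^ 18 + 2 * x ^ 19 + x ^ 21 - x ^ 24) * hx
  have hw1 := congrArg (powMap 3) hw
  have hw2 := congrArg (powMap 9) hw
  have hw3 := congrArg (powMap 5) hw
  have hw4 := congrArg (powMap 4) hw
  simp only [map_add, map_sub, map_mul, map_one, map_ofNat, powMap_powMap, powMap_mon]
    at hw1 hw2 hw3 hw4
  reduce_mod_char at hw1 hw2 hw3 hw4
  simp only [powMap_one, ← sub_eq_add_neg] at hw1 hw2 hw3 hw4
  rw [← hv, hN, hw, hw1, hw2, hw3, hw4]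
  simp only [map_add, map_mul, map_intCast, powMap_mon, periodElement]
  reduce_mod_char
  push_cast
  rw [h2, h3, h4, h5, h6, h7, h8, h9, h10]
  generalize mon 1 = x at hx
  linear_combination (a * (3 * x + x ^ 2 + 3 * x ^ 3 + 3 * x ^ 4 + x ^ 6 - x ^ 7) + b * (4 * x - x
        ^ 2 + 3 * x ^ 3 + 4 * x ^ 4 + 4 * x ^ 5 + x ^ 7 - x ^ 8) + c * (5 + 2 * x + x ^ 2 - x ^ 3 +
        3 * x ^ 4 + 3 * x ^ 5 - x ^ 7)) * hx

theorem exists_det_eq_periodElement_neg {p q r : ℤ}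
    (h : ∃ f, (twistedCirculant f).det = periodElement p q r) :
    ∃ f, (twistedCirculant f).det = periodElement (-p) (-q) (-r) := by
  obtain ⟨f, hf⟩ := h
  refine ⟨-f, ?_⟩
  have h2 : twistedCirculant (-f) = -twistedCirculant f := by
    ext1 i j
    simp [twistedCirculant]
  rw [h2, Matrix.det_neg, hf, periodElement, periodElement, ZMod.card]
  push_cast
  ring

theorem exists_det_eq_periodElement {p q r : ℤ}
    (h : ¬ (5 : ℤ) ∣ p + 5 * q + 5 * r ∨ (25 : ℤ) ∣ p + 5 * q + 5 * r) :
    ∃ f, (twistedCirculant f).det = periodElement p q r := by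
  rcases h with h | h
  · have h5 : p % 5 = 1 ∨ p % 5 = 2 ∨ p % 5 = 3 ∨ p % 5 = 4 := by omega
    rcases h5 with h5 | h5 | h5 | h5
    · obtain ⟨f, hf⟩ := exists_det_eq_periodElement_of_one (p / 5) q r
      exact ⟨f, by rw [hf]; congr 1; omega⟩
    · obtain ⟨f, hf⟩ := exists_det_eq_periodElement_of_two (p / 5) q r
      exact ⟨f, by rw [hf]; congr 1; omega⟩
    · obtain ⟨f, hf⟩ := exists_det_eq_periodElement_neg
        (exists_det_eq_periodElement_of_two (-p / 5) (-q) (-r))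
      exact ⟨f, by rw [hf]; congr 1 <;> omega⟩
    · obtain ⟨f, hf⟩ := exists_det_eq_periodElement_neg
        (exists_det_eq_periodElement_of_one (-p / 5) (-q) (-r))
      exact ⟨f, by rw [hf]; congr 1 <;> omega⟩
  · obtain ⟨k, hk⟩ := h
    obtain ⟨c, hc⟩ : ∃ c, p = 5 + 5 * c := ⟨p / 5 - 1, by omega⟩
    obtain ⟨f, hf⟩ := exists_det_eq_periodElement_of_dvd (k - r - c) r c
    exact ⟨f, by rw [hf]; congr 1 <;> omega⟩

theorem mainTheorem6 :
    integerGroupDets SmallGroup55 =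
      {d : ℤ | ∃ m α β : ℤ, (¬ (5 : ℤ) ∣ m ∨ (25 : ℤ) ∣ m) ∧
        (d : ℚ) = (m : ℚ) * (Algebra.norm ℚ
          ((m : QuadField11) + 11 * (α : QuadField11)
            + (1 / 2) * (11 + iSqrt11) * (β : QuadField11))) ^ 5} := by
  rw [integerGroupDets_smallGroup55_eq_range]
  ext d
  constructor
  · rintro ⟨f, rfl⟩
    exact det_leftMulMatrix55_mem f
  · rintro ⟨m, α, β, hm, hd⟩
    have hsum : m + 10 * α + 5 * β + 5 * -α + 5 * (-α - β) = m := by ring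
    obtain ⟨f, hf⟩ := exists_det_eq_periodElement
      (p := m + 10 * α + 5 * β) (q := -α) (r := -α - β) (by rwa [hsum])
    refine ⟨f, ?_⟩
    rw [norm_quadField11_integer] at hd
    have hd' : d = m * ((m + 11 * α) ^ 2 + 11 * (m + 11 * α) * β + 33 * β ^ 2) ^ 5 := by
      exact_mod_cast hd
    change (leftMulMatrix55 f).det = d
    rw [det_leftMulMatrix55_eq hf, hd', hsum]
    congr 2
    ring
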